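/- Write $I=\{0<1\}$ and let $V\subset I\times I$ be the sub-poset $\{(1,0),(0,0),(0,1)\}$. Let $(\mathcal M,\wedge)$ be a (not necessarily symmetric) monoidal model category that has a zero object $\star$ (for instance, any stable monoidal model category). Here a monoidal model category is a model category with functorial factorizations and a closed monoidal structure (tensoring with any object, on either side, is a left adjoint) that satisfies the pushout-product axiom and the unit axiom (some cofibrant replacement $QS\to S$ of the unit stays a weak equivalence after smashing, on either side, with any cofibrant object). For a finite poset $C$ let $\mathrm{Ho}(\mathcal M^C)$ be the localization of the category $\mathcal M^C$ of $C$-shaped diagrams at the vertex-wise weak equivalences. The functor $V_\star:\mathcal M^I\to\mathcal M^V$, sending $f:X\to Y$ to the diagram $\star\leftarrow X\xrightarrow{f}Y$ with $f$ at the edge $(0,0)<(0,1)$ and $\star$ at $(1,0)$, preserves weak equivalences and so induces $V_\star:\mathrm{Ho}(\mathcal M^I)\to\mathrm{Ho}(\mathcal M^V)$. The cone inclusion functor $\mathrm{Cone}:\mathrm{Ho}(\mathcal M^I)\to\mathrm{Ho}(\mathcal M^I)$ is $$\mathrm{Cone}(f)=\bigl(\mathrm{HoLKan}_{V\subset I\times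 I}\,V_\star(f)\bigr)\big|_{(0,1)<(1,1)},$$ where $\mathrm{HoLKan}_{V\subset I\times I}$ is the total left derived functor of the left Kan extension $\mathcal M^V\to\mathcal M^{I\times I}$. Thus $\mathrm{Cone}(X\to Y)$ is the map from $Y$ to the homotopy cofibre of $X\to Y$. For $f:X\to Y$ and $g:U\to W$ in $\mathcal M^I$ let $f\,\Box\,g: X\wedge W\sqcup_{X\wedge U}Y\wedge U\to Y\wedge W$ be the pushout smash product, and let $f\wedge_I g: X\wedge U\to Y\wedge W$ be the internal (vertex-wise) smash product. Then the left Kan extension $\mathcal M^V\to\mathcal M^{I\times I}$ and the functors $\Box,\wedge_I:\mathcal M^I\times\mathcal M^I\to\mathcal M^I$ have total left derived functors, the latter two being denoted $\Box^L,\wedge_I^L:\mathrm{Ho}(\mathcal M^I)\times\mathrm{Ho}(\mathcal M^I)\to\mathrm{Ho}(\mathcal M^I)$, and there is an isomorphism of functors $\mathrm{Ho}(\mathcal M^I)\times\mathrm{Ho}(\mathcal M^I)\to\mathrm{Ho}(\mathcal M^I)$ $$\mathrm{Cone}(-\,\Box^L-)\;\cong\;\mathrm{Cone}(-)\wedge_I^L\mathrm{Cone}(-).$$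 -/

import Mathlib

open CategoryTheory Limits HomotopicalAlgebra MonoidalCategory ZeroObject

universe v u

noncomputable section

namespace DiagramCone

/-- A monoidal model category: a closed monoidal structure on a model category with functorial
factorizations, satisfying the pushout-product axiom and the unit axiom. No symmetry is required,
so "closed" means that tensoring with an object on either side is a left adjoint. -/
class MonoidalModelCategory (M : Type u) [Category.{v} M] [ModelCategory M]
    [MonoidalCategory M] : Prop where
  tensorLeft_isLeftAdjoint (X : M) : (tensorLeft X).IsLeftAdjoint
  tensorRight_isLeftAdjoint (X : M) : (tensorRight X).IsLeftAdjoint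
  functorialFactorization_trivialCofibration :
    (trivialCofibrations M).HasFunctorialFactorization (fibrations M)
  functorialFactorization_trivialFibration :
    (cofibrations M).HasFunctorialFactorization (trivialFibrations M)
  cofibration_pushoutProduct (f g : Arrow M) :
    Cofibration f.hom → Cofibration g.hom →
      Cofibration ((MonoidalCategory.Arrow.pushoutProduct.obj f).obj g).hom
  weakEquivalence_pushoutProduct (f g : Arrow M) :
    Cofibration f.hom → Cofibration g.hom → WeakEquivalence f.hom ∨ WeakEquivalence g.hom →
      WeakEquivalence ((MonoidalCategory.Arrow.pushoutProduct.obj f).obj g).hom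
  unit_cofibrantReplacement :
    ∃ (QS : M) (q : QS ⟶ 𝟙_ M), IsCofibrant QS ∧ Fibration q ∧ WeakEquivalence q ∧
      ∀ X : M, IsCofibrant X → WeakEquivalence (q ▷ X) ∧ WeakEquivalence (X ◁ q)

/-! ### Homotopy categories of diagrams -/

section Ho

variable (M : Type u) [Category.{v} M] [ModelCategory M]

/-- The vertex-wise weak equivalences between diagrams of shape `J`. -/
abbrev diagW (J : Type) [Category.{0} J] : MorphismProperty (J ⥤ M) :=
  (weakEquivalences M).functorCategory J

instance (J : Type) [Category.{0} J] : (diagW M J).ContainsIdentities :=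
  ⟨fun _ _ => (weakEquivalences M).id_mem _⟩

/-- The homotopy category of diagrams of shape `J` in `M`. -/
abbrev Ho (J : Type) [Category.{0} J] := (diagW M J).Localization

/-- The localization functor from diagrams to the homotopy category of diagrams. -/
abbrev toHo (J : Type) [Category.{0} J] : (J ⥤ M) ⥤ Ho M J := (diagW M J).Q

end Ho

/-! ### The cone inclusion functor -/

/-- The poset `{0 < 1}`. -/
abbrev I : Type := Fin 2

/-- The condition on vertices of `I × I` defining the sub-poset `V`. -/
abbrev cornerProp : ObjectProperty (I × I) := fun p => p ≠ (1, 1)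

/-- The sub-poset of `I × I` with elements `(1, 0)`, `(0, 0)`, `(0, 1)`. -/
abbrev V : Type := cornerProp.FullSubcategory

/-- The inclusion of `V` in `I × I`. -/
abbrev cornerIncl : V ⥤ I × I := cornerProp.ι

instance : Finite V :=
  Finite.of_injective (fun p : V => p.obj) (fun p q h => by cases p; cases q; cases h; rfl)

instance (p q : I × I) : Subsingleton (p ⟶ q) :=
  ⟨fun _ _ => Prod.ext (Subsingleton.elim _ _) (Subsingleton.elim _ _)⟩

instance (p q : V) : Subsingleton (p ⟶ q) :=
  ⟨fun a b => InducedCategory.hom_ext (Subsingleton.elim a.hom b.hom)⟩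

instance (p : I × I) : Finite (CostructuredArrow cornerIncl p) :=
  Finite.of_injective (fun a => a.left) (by
    rintro ⟨a, ⟨⟨⟩⟩, (f : a.obj ⟶ p)⟩ ⟨b, ⟨⟨⟩⟩, (g : b.obj ⟶ p)⟩ h
    obtain rfl : a = b := h
    obtain rfl : f = g := Subsingleton.elim _ _
    rfl)

instance (p : I × I) (a b : CostructuredArrow cornerIncl p) : Subsingleton (a ⟶ b) :=
  ⟨fun _ _ => CostructuredArrow.hom_ext _ _ (Subsingleton.elim _ _)⟩

instance (p : I × I) : FinCategory (CostructuredArrow cornerIncl p) where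
  fintypeObj := Fintype.ofFinite _
  fintypeHom _ _ := Fintype.ofFinite _

section Cone

variable (M : Type u) [Category.{v} M]

instance [HasFiniteColimits M] (F : V ⥤ M) : cornerIncl.HasPointwiseLeftKanExtension F :=
  fun _ => inferInstanceAs (HasColimit _)

variable [HasZeroObject M] [HasZeroMorphisms M]

/-- The functor sending `f : X ⟶ Y` to the diagram of shape `V`
with `f` at the edge `(0, 0) ≤ (0, 1)` and the strict zero object at the vertex `(1, 0)`.
It is the restriction to `V` of the square `f ⟶ (0 ⟶ 0)`, the first coordinate of `I × I` being
the direction of this map of arrows. -/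
def starDiagram : (I ⥤ M) ⥤ (V ⥤ M) where
  obj f := cornerIncl ⋙ Functor.uncurry.obj
    (ComposableArrows.mk₁ (0 : f ⟶ (Functor.const I).obj (0 : M)))
  map φ := Functor.whiskerLeft cornerIncl (Functor.uncurry.map
    (ComposableArrows.homMk₁ φ (𝟙 _) (zero_comp.trans comp_zero.symm)))
  map_id f := by
    ext ⟨⟨i, j⟩, h⟩
    fin_cases i <;> rfl
  map_comp φ ψ := by
    ext ⟨⟨i, j⟩, h⟩
    fin_cases i
    · rfl
    · exact (Category.comp_id (𝟙 (0 : M))).symm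

end Cone

variable (M : Type u) [Category.{v} M] [ModelCategory M]

section

variable [HasZeroObject M] [HasZeroMorphisms M]

/-- `starDiagram` preserves vertex-wise weak equivalences. -/
def starLocalizerMorphism : LocalizerMorphism (diagW M I) (diagW M V) where
  functor := starDiagram M
  map := by
    rintro X Y φ hφ ⟨⟨i, j⟩, h⟩
    fin_cases i
    · exact hφ j
    · exact (weakEquivalences M).id_mem (0 : M)

/-- The functor `Ho(M^I) ⥤ Ho(M^V)` induced by `starDiagram`. -/
def starHo : Ho M I ⥤ Ho M V :=
  (starLocalizerMorphism M).localizedFunctor (toHo M I) (toHo M V)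

end

/-- Strict left Kan extension along `V ⊂ I × I`, with values in the homotopy category. -/
def cornerLan : (V ⥤ M) ⥤ Ho M (I × I) := cornerIncl.lan ⋙ toHo M (I × I)

/-- The left homotopy Kan extension along `V ⊂ I × I`:
the total left derived functor of the strict left Kan extension. -/
def cornerHoLan [(cornerLan M).HasLeftDerivedFunctor (diagW M V)] : Ho M V ⥤ Ho M (I × I) :=
  (cornerLan M).totalLeftDerived (toHo M V) (diagW M V)

/-- Restriction of squares to the edge `(0, 1) < (1, 1)`. -/
def edgeLocalizerMorphism : LocalizerMorphism (diagW M (I × I)) (diagW M I) where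
  functor := (Functor.whiskeringLeft I (I × I) M).obj (Prod.sectL I (1 : I))
  map _ _ _ hφ i := hφ (i, 1)

/-- The functor `Ho(M^(I × I)) ⥤ Ho(M^I)` restricting a square to the edge `(0, 1) < (1, 1)`. -/
def edgeHo : Ho M (I × I) ⥤ Ho M I :=
  (edgeLocalizerMorphism M).localizedFunctor (toHo M (I × I)) (toHo M I)

/-- The cone inclusion functor `Cone : Ho(M^I) ⥤ Ho(M^I)`, sending `f : X ⟶ Y` to `Y ⟶ cone f`:
the edge `(0, 1) < (1, 1)` of the left homotopy Kan extension of `0 ⟵ X ⟶ Y` to `I × I`. -/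
def coneInclusion [HasZeroObject M] [HasZeroMorphisms M]
    [(cornerLan M).HasLeftDerivedFunctor (diagW M V)] : Ho M I ⥤ Ho M I :=
  starHo M ⋙ cornerHoLan M ⋙ edgeHo M

/-! ### The derived pushout smash product and the derived internal smash product -/

section

variable (C : Type u) [Category.{v} C]

/-- A diagram of shape `I` as an object of the arrow category. -/
def diagramToArrow : (I ⥤ C) ⥤ Arrow C where
  obj f := Arrow.mk (f.map (homOfLE (by decide) : (0 : I) ⟶ 1))
  map φ := Arrow.homMk (φ.app 0) (φ.app 1) (φ.naturality _).symm

/-- An arrow as a diagram of shape `I`. -/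
def arrowToDiagram : Arrow C ⥤ (I ⥤ C) where
  obj f := ComposableArrows.mk₁ f.hom
  map φ := ComposableArrows.homMk₁ φ.left φ.right φ.w.symm
  map_id _ := ComposableArrows.hom_ext₁ rfl rfl
  map_comp _ _ := ComposableArrows.hom_ext₁ rfl rfl

end

variable [MonoidalCategory M]

/-- The strict pushout smash product `f □ g : X ∧ V ⊔_{X ∧ U} Y ∧ U ⟶ Y ∧ V` of
`f : X ⟶ Y` and `g : U ⟶ V`, as a functor of diagrams of shape `I`. -/
def box : (I ⥤ M) × (I ⥤ M) ⥤ (I ⥤ M) :=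
  (diagramToArrow M).prod (diagramToArrow M) ⋙
    Functor.uncurry.obj MonoidalCategory.Arrow.pushoutProduct ⋙ arrowToDiagram M

/-- The strict internal smash product on `M^I`, given vertex-wise by `(X ∧ Y) i = X i ∧ Y i`. -/
def smash : (I ⥤ M) × (I ⥤ M) ⥤ (I ⥤ M) := MonoidalCategory.tensor (I ⥤ M)

/-- A functor of two variables `M^I × M^I ⥤ M^I` has a total left derived functor. -/
abbrev HasDerived₂ (F : (I ⥤ M) × (I ⥤ M) ⥤ (I ⥤ M)) : Prop :=
  (F ⋙ toHo M I).HasLeftDerivedFunctor ((diagW M I).prod (diagW M I))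

/-- The total left derived functor `Ho(M^I) × Ho(M^I) ⥤ Ho(M^I)` of a functor
`M^I × M^I ⥤ M^I`. -/
def derived₂ (F : (I ⥤ M) × (I ⥤ M) ⥤ (I ⥤ M)) [HasDerived₂ M F] :
    Ho M I × Ho M I ⥤ Ho M I :=
  (F ⋙ toHo M I).totalLeftDerived ((toHo M I).prod (toHo M I)) ((diagW M I).prod (diagW M I))

end DiagramCone

end

noncomputable section

namespace DiagramCone

/-!
On a cofibration `f : X ⟶ Y` between cofibrant objects, the cone inclusion of `f` is computed by
the strict cofibre `Y ⟶ Y / X`, which has cofibrant ends; moreover the pushout product of two such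
cofibrations is again one. Hence both composites of the theorem are left derived functors, of the
strict cofibre of the pushout product and of the tensor product of strict cofibres respectively.
These strict functors are isomorphic: since tensoring preserves pushouts and zero objects, the
cofibre of `X ⊗ W ⊔ Y ⊗ U ⟶ Y ⊗ W` is `Y ⊗ W ⟶ (Y / X) ⊗ (W / U)`. It remains to use that left
derived functors are unique.
-/

/-! ### The gluing lemma -/

section Gluing

variable {M : Type*} [Category* M] [ModelCategory M] {A A' B B' C C' P P' : M}

lemma cofibration_of_isPushout {f : A ⟶ B} {g : A ⟶ C} {h : B ⟶ P} {k : C ⟶ P}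
    (sq : IsPushout f g h k) [hg : Cofibration g] : Cofibration h := by
  rw [cofibration_iff] at hg ⊢
  exact MorphismProperty.of_isPushout sq hg

lemma weakEquivalence_of_isPushout_of_trivialCofibration {f : A ⟶ B} {g : A ⟶ C} {h : B ⟶ P}
    {k : C ⟶ P} (sq : IsPushout f g h k) [Cofibration g] [WeakEquivalence g] :
    WeakEquivalence h := by
  rw [weakEquivalence_iff]
  exact (MorphismProperty.of_isPushout (P := trivialCofibrations M) sq
    (mem_trivialCofibrations g)).2

lemma weakEquivalence_pushoutMap_of_trivialCofibration {f : A ⟶ B} {g : A ⟶ C} {h : B ⟶ P}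
    {k : C ⟶ P} (sq : IsPushout f g h k) {g' : A ⟶ C'} {h' : B ⟶ P'} {k' : C' ⟶ P'}
    (sq' : IsPushout f g' h' k') {φ : C ⟶ C'} {π : P ⟶ P'} (wg : g ≫ φ = g')
    (wh : h ≫ π = h') (wk : k ≫ π = φ ≫ k') [Cofibration φ] [WeakEquivalence φ] :
    WeakEquivalence π :=
  weakEquivalence_of_isPushout_of_trivialCofibration
    (IsPushout.of_top (by simpa only [wg, wh] using sq') wk sq)

/-- Ken Brown's argument, applied to cobase change along `f` as a functor on objects under `A`. -/
lemma weakEquivalence_pushoutMap_of_cofibration {f : A ⟶ B} {g : A ⟶ C} {h : B ⟶ P}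
    {k : C ⟶ P} (sq : IsPushout f g h k) {g' : A ⟶ C'} {h' : B ⟶ P'} {k' : C' ⟶ P'}
    (sq' : IsPushout f g' h' k') {φ : C ⟶ C'} {π : P ⟶ P'} (wg : g ≫ φ = g')
    (wh : h ≫ π = h') (wk : k ≫ π = φ ≫ k') [Cofibration g] [Cofibration g']
    [WeakEquivalence φ] : WeakEquivalence π := by
  have sqD := IsPushout.of_hasPushout g g'
  let d := MorphismProperty.factorizationData (cofibrations M) (trivialFibrations M)
    (sqD.desc φ (𝟙 C') (by simp [wg]))
  have : Cofibration d.i := ⟨d.hi⟩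
  have : WeakEquivalence d.p := ⟨d.hp.2⟩
  have : Cofibration (pushout.inl g g') := cofibration_of_isPushout sqD
  have : Cofibration (pushout.inr g g') := cofibration_of_isPushout sqD.flip
  let i := pushout.inl g g' ≫ d.i
  let s := pushout.inr g g' ≫ d.i
  have i_p : i ≫ d.p = φ := by simp [i]
  have s_p : s ≫ d.p = 𝟙 C' := by simp [s]
  have : WeakEquivalence i := weakEquivalence_of_postcomp_of_fac i_p
  have : WeakEquivalence s := weakEquivalence_of_postcomp_of_fac s_p
  have w : g' ≫ s = g ≫ i := by simp [i, s, reassoc_of% sqD.w]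
  have sqQ := IsPushout.of_hasPushout f (g ≫ i)
  let toP' : pushout f (g ≫ i) ⟶ P' := sqQ.desc h' (d.p ≫ k') (by
    rw [sq'.w, Category.assoc, reassoc_of% i_p, reassoc_of% wg])
  let iP : P ⟶ pushout f (g ≫ i) := sq.desc (pushout.inl _ _) (i ≫ pushout.inr _ _) (by
    rw [sqQ.w, Category.assoc])
  let sP : P' ⟶ pushout f (g ≫ i) := sq'.desc (pushout.inl _ _) (s ≫ pushout.inr _ _) (by
    rw [reassoc_of% w, sqQ.w, Category.assoc])
  have : WeakEquivalence iP := weakEquivalence_pushoutMap_of_trivialCofibration sq sqQ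
    (φ := i) rfl (sq.inl_desc _ _ _) (sq.inr_desc _ _ _)
  have : WeakEquivalence sP := weakEquivalence_pushoutMap_of_trivialCofibration sq' sqQ
    (φ := s) w (sq'.inl_desc _ _ _) (sq'.inr_desc _ _ _)
  have iP_toP' : iP ≫ toP' = π := sq.hom_ext (by simp [iP, toP', wh])
    (by simp [iP, toP', wk, reassoc_of% i_p])
  have sP_toP' : sP ≫ toP' = 𝟙 P' := sq'.hom_ext (by simp [sP, toP'])
    (by simp [sP, toP', reassoc_of% s_p])
  have : WeakEquivalence toP' := weakEquivalence_of_precomp_of_fac sP_toP'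
  rw [← iP_toP']
  infer_instance

lemma weakEquivalence_of_isPushout_of_section {f : A ⟶ B} {g : A ⟶ C} {h : B ⟶ P} {k : C ⟶ P}
    (sq : IsPushout f g h k) [Cofibration g] {s : B ⟶ A} (s_f : s ≫ f = 𝟙 B) [Cofibration s]
    [WeakEquivalence s] : WeakEquivalence k := by
  let d := MorphismProperty.factorizationData (cofibrations M) (trivialFibrations M) (s ≫ g)
  have : Cofibration d.i := ⟨d.hi⟩
  have : WeakEquivalence d.p := ⟨d.hp.2⟩
  have sqE := IsPushout.of_hasPushout s d.i
  let φ : pushout s d.i ⟶ C := sqE.desc g d.p d.fac.symm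
  have : Cofibration (pushout.inl s d.i) := cofibration_of_isPushout sqE
  have : WeakEquivalence (pushout.inr s d.i) :=
    weakEquivalence_of_isPushout_of_trivialCofibration sqE.flip
  have : WeakEquivalence φ := weakEquivalence_of_precomp_of_fac (sqE.inr_desc _ _ d.fac.symm)
  let r : pushout s d.i ⟶ d.Z := sqE.desc (f ≫ d.i) (𝟙 _) (by simp [reassoc_of% s_f])
  have sqr : IsPushout f (pushout.inl s d.i) d.i r :=
    IsPushout.of_left (h₁₁ := s) (v₁₁ := d.i) (h₂₁ := pushout.inr s d.i)
      (by simpa [s_f, r] using IsPushout.of_id_fst) (by simp [r]) sqE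
  have i_p_k : d.i ≫ d.p ≫ k = h := by simp [← sq.w, reassoc_of% s_f]
  have r_p_k : r ≫ d.p ≫ k = φ ≫ k :=
    sqE.hom_ext (by simp only [r, φ, sqE.inl_desc_assoc, Category.assoc, i_p_k, sq.w])
      (by simp [φ, r])
  have : WeakEquivalence (d.p ≫ k) :=
    weakEquivalence_pushoutMap_of_cofibration sqr sq (sqE.inl_desc _ _ _) i_p_k r_p_k
  exact weakEquivalence_of_precomp d.p k

lemma weakEquivalence_of_isPushout_of_isCofibrant {f : A ⟶ B} {g : A ⟶ C} {h : B ⟶ P}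
    {k : C ⟶ P} (sq : IsPushout f g h k) [IsCofibrant A] [IsCofibrant B] [Cofibration g]
    [WeakEquivalence f] : WeakEquivalence k := by
  obtain ⟨d⟩ : Nonempty (CofibrantBrownFactorization f) := inferInstance
  have : Cofibration d.i := ⟨d.hi⟩
  have sqT := IsPushout.of_hasPushout d.i g
  have : Cofibration (pushout.inl d.i g) := cofibration_of_isPushout sqT
  have : WeakEquivalence (pushout.inr d.i g) :=
    weakEquivalence_of_isPushout_of_trivialCofibration sqT.flip
  have w : d.i ≫ d.p ≫ h = g ≫ k := by simp [sq.w]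
  let r : pushout d.i g ⟶ P := sqT.desc (d.p ≫ h) k w
  have sqr : IsPushout d.p (pushout.inl d.i g) h r :=
    IsPushout.of_left (by simpa [r] using sq) (by simp [r]) sqT
  have : WeakEquivalence r := weakEquivalence_of_isPushout_of_section sqr d.s_p
  rw [← sqT.inr_desc _ _ w]
  infer_instance

lemma weakEquivalence_pushoutMap
    {f : A ⟶ B} {g : A ⟶ C} {h : B ⟶ P} {k : C ⟶ P} (sq : IsPushout f g h k)
    {f' : A' ⟶ B'} {g' : A' ⟶ C'} {h' : B' ⟶ P'} {k' : C' ⟶ P'} (sq' : IsPushout f' g' h' k')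
    {α : A ⟶ A'} {β : B ⟶ B'} {γ : C ⟶ C'} {π : P ⟶ P'}
    (wf : f ≫ β = α ≫ f') (wg : g ≫ γ = α ≫ g') (wh : h ≫ π = β ≫ h') (wk : k ≫ π = γ ≫ k')
    [IsCofibrant A] [IsCofibrant A'] [IsCofibrant B] [IsCofibrant B']
    [Cofibration g] [Cofibration g']
    [WeakEquivalence α] [WeakEquivalence β] [WeakEquivalence γ] : WeakEquivalence π := by
  have sqC := IsPushout.of_hasPushout α g
  have sqP := IsPushout.of_hasPushout β h
  have : Cofibration h := cofibration_of_isPushout sq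
  have : Cofibration (pushout.inl α g) := cofibration_of_isPushout sqC
  have : WeakEquivalence (pushout.inr α g) := weakEquivalence_of_isPushout_of_isCofibrant sqC
  have : WeakEquivalence (pushout.inr β h) := weakEquivalence_of_isPushout_of_isCofibrant sqP
  let γ' : pushout α g ⟶ C' := sqC.desc g' γ wg.symm
  have : WeakEquivalence γ' := weakEquivalence_of_precomp_of_fac (sqC.inr_desc _ _ wg.symm)
  let π' : pushout β h ⟶ P' := sqP.desc h' π wh.symm
  have w : α ≫ f' ≫ pushout.inl β h = g ≫ k ≫ pushout.inr β h := by
    rw [← reassoc_of% wf, pushout.condition, reassoc_of% sq.w]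
  have sqB : IsPushout f' (pushout.inl α g) (pushout.inl β h)
      (sqC.desc (f' ≫ pushout.inl β h) (k ≫ pushout.inr β h) w) :=
    IsPushout.of_left (by simpa [wf] using (sq.flip.paste_vert sqP.flip).flip) (by simp) sqC
  have γ'_π' : sqC.desc (f' ≫ pushout.inl β h) (k ≫ pushout.inr β h) w ≫ π' = γ' ≫ k' :=
    sqC.hom_ext (by simp [γ', π', sq'.w]) (by simp [γ', π', wk])
  have : WeakEquivalence π' := weakEquivalence_pushoutMap_of_cofibration sqB sq' (φ := γ')
    (sqC.inl_desc _ _ _) (sqP.inl_desc _ _ _) γ'_π'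
  rw [← sqP.inr_desc h' π wh.symm]
  infer_instance

end Gluing

/-! ### Left deformations and derived functors -/

section Deformation

variable {C D H : Type*} [Category* C] [Category* D] [Category* H]

/-- A left deformation of `(C, W)` into `P`: functorial resolutions, up to `W`, of all objects by
objects satisfying `P`. It computes left derived functors of the functors that send the elements
of `W` between objects satisfying `P` to isomorphisms. -/
structure LeftDeformation (W : MorphismProperty C) (P : ObjectProperty C) where
  /-- The resolution functor. -/
  Q : C ⥤ C
  /-- The augmentation of the resolutions. -/
  q : Q ⟶ 𝟭 C
  prop_obj (X : C) : P (Q.obj X)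
  weq_app (X : C) : W (q.app X)

namespace LeftDeformation

variable {W : MorphismProperty C} {P : ObjectProperty C}

/-- Enlarging the class of resolving objects. -/
def ofLE (d : LeftDeformation W P) {P' : ObjectProperty C} (h : P ≤ P') :
    LeftDeformation W P' where
  Q := d.Q
  q := d.q
  prop_obj X := h _ (d.prop_obj X)
  weq_app := d.weq_app

/-- The product of two left deformations. -/
def prod {C' : Type*} [Category* C'] {W' : MorphismProperty C'} {P' : ObjectProperty C'}
    (d : LeftDeformation W P) (d' : LeftDeformation W' P') :
    LeftDeformation (W.prod W') (fun X => P X.1 ∧ P' X.2) where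
  Q := d.Q.prod d'.Q
  q := { app X := (d.q.app X.1, d'.q.app X.2)
         naturality _ _ f := Prod.ext (d.q.naturality f.1) (d'.q.naturality f.2) }
  prop_obj X := ⟨d.prop_obj X.1, d'.prop_obj X.2⟩
  weq_app X := ⟨d.weq_app X.1, d'.weq_app X.2⟩

variable (d : LeftDeformation W P)

lemma map_weq [W.HasTwoOutOfThreeProperty] {X Y : C} (f : X ⟶ Y) (hf : W f) :
    W (d.Q.map f) :=
  (W.postcomp_iff _ _ (d.weq_app Y)).1
    (d.q.naturality f ▸ W.comp_mem _ _ (d.weq_app X) hf)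

variable (L : C ⥤ D) [L.IsLocalization W]

lemma isIso_map_app (X : C) : IsIso (L.map (d.q.app X)) :=
  Localization.inverts L W _ (d.weq_app X)

instance isIso_whiskerRight (G : D ⥤ H) : IsIso (Functor.whiskerRight d.q (L ⋙ G)) :=
  have (X : C) : IsIso ((Functor.whiskerRight d.q (L ⋙ G)).app X) := by
    have := d.isIso_map_app L X
    dsimp only [Functor.whiskerRight_app, Functor.comp_map]
    infer_instance
  NatIso.isIso_of_isIso_app _

lemma isIso_whiskerLeft {F G : C ⥤ H} (α : G ⟶ F) (hα : ∀ X, P X → IsIso (α.app X)) :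
    IsIso (Functor.whiskerLeft d.Q α) :=
  have (X : C) : IsIso ((Functor.whiskerLeft d.Q α).app X) := hα _ (d.prop_obj X)
  NatIso.isIso_of_isIso_app _

variable {L} {F : C ⥤ H}

include d

lemma exists_fac_of_isIso_app {LF : D ⥤ H} (α : L ⋙ LF ⟶ F)
    (hα : ∀ X, P X → IsIso (α.app X)) {G : D ⥤ H} (β : L ⋙ G ⟶ F) :
    ∃ γ : G ⟶ LF, Functor.whiskerLeft L γ ≫ α = β := by
  have := d.isIso_whiskerLeft α hα
  let γ : L ⋙ G ⟶ L ⋙ LF := (L ⋙ G).leftUnitor.inv ≫ inv (Functor.whiskerRight d.q (L ⋙ G)) ≫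
    Functor.whiskerLeft d.Q β ≫ inv (Functor.whiskerLeft d.Q α) ≫
    Functor.whiskerRight d.q (L ⋙ LF) ≫ (L ⋙ LF).leftUnitor.hom
  refine ⟨Localization.liftNatTrans L W _ _ G LF γ, ?_⟩
  ext X
  have := d.isIso_map_app L X
  have := hα _ (d.prop_obj X)
  have hγ : (Localization.liftNatTrans L W (L ⋙ G) (L ⋙ LF) G LF γ).app (L.obj X) = γ.app X := by
    simp
  have α_nat : LF.map (L.map (d.q.app X)) ≫ α.app X = α.app (d.Q.obj X) ≫ F.map (d.q.app X) :=
    α.naturality (d.q.app X)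
  have β_nat : G.map (L.map (d.q.app X)) ≫ β.app X = β.app (d.Q.obj X) ≫ F.map (d.q.app X) :=
    β.naturality (d.q.app X)
  simp [hγ, γ, α_nat, β_nat]

lemma natTrans_ext_of_isIso_app {LF : D ⥤ H} {α : L ⋙ LF ⟶ F}
    (hα : ∀ X, P X → IsIso (α.app X)) {G : D ⥤ H} {γ γ' : G ⟶ LF}
    (h : Functor.whiskerLeft L γ ≫ α = Functor.whiskerLeft L γ' ≫ α) : γ = γ' := by
  have h_prop (X : C) (hX : P X) : γ.app (L.obj X) = γ'.app (L.obj X) := by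
    have := hα X hX
    exact (cancel_mono (α.app X)).1 (NatTrans.congr_app h X)
  refine Localization.natTrans_ext L W fun X => ?_
  have := d.isIso_map_app L X
  rw [← cancel_epi (G.map (L.map (d.q.app X)))]
  exact (γ.naturality _).trans
    ((h_prop _ (d.prop_obj X) =≫ _).trans (γ'.naturality _).symm)

lemma isLeftDerivedFunctor_of_isIso_app {LF : D ⥤ H} (α : L ⋙ LF ⟶ F)
    (hα : ∀ X, P X → IsIso (α.app X)) : LF.IsLeftDerivedFunctor α W where
  isRightKanExtension := by
    choose lift hlift using fun G => d.exists_fac_of_isIso_app α hα (G := G)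
    exact ⟨⟨IsTerminal.ofUniqueHom
      (fun G => CostructuredArrow.homMk (lift _ G.hom) (hlift _ G.hom))
      fun G γ => CostructuredArrow.hom_ext _ _ (d.natTrans_ext_of_isIso_app hα
        ((CostructuredArrow.w γ).trans (hlift _ G.hom).symm))⟩⟩

variable [W.HasTwoOutOfThreeProperty]
  (hF : ∀ ⦃X Y : C⦄ (f : X ⟶ Y), P X → P Y → W f → IsIso (F.map f))

include hF

variable (L) in
lemma exists_counit_isIso_app : ∃ (LF : D ⥤ H) (α : L ⋙ LF ⟶ F), ∀ X, P X → IsIso (α.app X) := by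
  have hQF : W.IsInvertedBy (d.Q ⋙ F) := fun _ _ f hf =>
    hF _ (d.prop_obj _) (d.prop_obj _) (d.map_weq f hf)
  refine ⟨Localization.lift (d.Q ⋙ F) hQF L,
    (Localization.fac _ _ _).hom ≫ Functor.whiskerRight d.q F, fun X hX => ?_⟩
  have := hF (d.q.app X) (d.prop_obj X) hX (d.weq_app X)
  dsimp only [NatTrans.comp_app, Functor.whiskerRight_app]
  infer_instance

lemma hasLeftDerivedFunctor : F.HasLeftDerivedFunctor W := by
  obtain ⟨LF, α, hα⟩ := d.exists_counit_isIso_app W.Q hF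
  have := d.isLeftDerivedFunctor_of_isIso_app α hα
  exact Functor.HasLeftDerivedFunctor.mk' LF α

lemma isIso_app_of_isLeftDerivedFunctor {LF : D ⥤ H} (α : L ⋙ LF ⟶ F)
    [LF.IsLeftDerivedFunctor α W] {X : C} (hX : P X) : IsIso (α.app X) := by
  obtain ⟨LF', α', hα'⟩ := d.exists_counit_isIso_app L hF
  have := d.isLeftDerivedFunctor_of_isIso_app α' hα'
  have := hα' X hX
  have := (Functor.isLeftDerivedFunctor_iff_isIso_leftDerivedLift LF' α' W LF α).1 inferInstance
  have fac : (LF'.leftDerivedLift α' W LF α).app (L.obj X) ≫ α'.app X = α.app X :=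
    NatTrans.congr_app (Functor.leftDerived_fac LF' α' W LF α) X
  rw [← fac]
  infer_instance

end LeftDeformation

end Deformation

/-! ### Cofibrant resolutions of diagrams -/

section Shapes

/-- The edge of the poset `{0 < 1}`. -/
abbrev edgeI : (0 : I) ⟶ 1 := homOfLE (by decide)

/-- The vertex `(0, 0)` of `V`. -/
abbrev v₀₀ : V := ⟨(0, 0), by decide⟩

/-- The vertex `(0, 1)` of `V`. -/
abbrev v₀₁ : V := ⟨(0, 1), by decide⟩

/-- The vertex `(1, 0)` of `V`. -/
abbrev v₁₀ : V := ⟨(1, 0), by decide⟩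

/-- The edge `(0, 0) ≤ (0, 1)` of `V`. -/
abbrev e₀₁ : v₀₀ ⟶ v₀₁ := ObjectProperty.homMk (show ((0, 0) : I × I) ⟶ (0, 1) from (𝟙 _, edgeI))

/-- The edge `(0, 0) ≤ (1, 0)` of `V`. -/
abbrev e₁₀ : v₀₀ ⟶ v₁₀ := ObjectProperty.homMk (show ((0, 0) : I × I) ⟶ (1, 0) from (edgeI, 𝟙 _))

lemma forall_V {p : V → Prop} (h₀₀ : p v₀₀) (h₀₁ : p v₀₁) (h₁₀ : p v₁₀) (v : V) : p v := by
  obtain ⟨⟨i, j⟩, h⟩ := v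
  fin_cases i <;> fin_cases j
  · exact h₀₀
  · exact h₀₁
  · exact h₁₀
  · exact absurd rfl h

variable {N : Type*} [Category* N]

/-- The natural transformation of diagrams of shape `V` with the given components. -/
def natTransV {F G : V ⥤ N} (a : F.obj v₀₀ ⟶ G.obj v₀₀) (b : F.obj v₁₀ ⟶ G.obj v₁₀)
    (c : F.obj v₀₁ ⟶ G.obj v₀₁) (hb : F.map e₁₀ ≫ b = a ≫ G.map e₁₀)
    (hc : F.map e₀₁ ≫ c = a ≫ G.map e₀₁) : F ⟶ G where
  app v := match v with
    | ⟨(0, 0), _⟩ => a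
    | ⟨(0, 1), _⟩ => c
    | ⟨(1, 0), _⟩ => b
    | ⟨(1, 1), h⟩ => absurd rfl h
  naturality := by
    have eq_id {v : V} (f : v ⟶ v) : f = 𝟙 v := Subsingleton.elim _ _
    refine forall_V (forall_V ?_ ?_ ?_) (forall_V ?_ ?_ ?_) (forall_V ?_ ?_ ?_) <;> intro f
    · simp [eq_id f]
    · exact hc
    · exact hb
    · exact absurd (leOfHom f.hom.2) (by decide)
    · simp [eq_id f]
    · exact absurd (leOfHom f.hom.2) (by decide)
    · exact absurd (leOfHom f.hom.1) (by decide)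
    · exact absurd (leOfHom f.hom.1) (by decide)
    · simp [eq_id f]

variable {A B C : N} [HasTerminal N]

/-- The diagram `B ⟵ A ⟶ C` of shape `V`, obtained by restricting a square
whose vertex `(1, 1)` is filled with a terminal object. -/
def spanV (f : A ⟶ B) (g : A ⟶ C) : V ⥤ N :=
  cornerIncl ⋙ Functor.uncurry.obj (ComposableArrows.mk₁
    (ComposableArrows.homMk₁ f (terminal.from C)
      (terminal.hom_ext (g ≫ terminal.from C) (f ≫ terminal.from B)) :
      ComposableArrows.mk₁ g ⟶ ComposableArrows.mk₁ (terminal.from B)))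

lemma spanV_map_e₀₁ (f : A ⟶ B) (g : A ⟶ C) : (spanV f g).map e₀₁ = g :=
  Category.id_comp g

lemma spanV_map_e₁₀ (f : A ⟶ B) (g : A ⟶ C) : (spanV f g).map e₁₀ = f :=
  Category.comp_id f

end Shapes

section Resolutions

section Factorization

variable {N : Type*} [Category* N] (C W : MorphismProperty N) [C.HasFactorization W]

lemma exists_resolution_I (F : I ⥤ N) {O : N} (o : O ⟶ F.obj 0) :
    ∃ (G : I ⥤ N) (φ : G ⟶ F) (o' : O ⟶ G.obj 0), (∀ i, W (φ.app i)) ∧ C o' ∧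
      C (G.map edgeI) := by
  let d := MorphismProperty.factorizationData C W o
  let d₁ := MorphismProperty.factorizationData C W (d.p ≫ F.map edgeI)
  exact ⟨ComposableArrows.mk₁ d₁.i, ComposableArrows.homMk₁ d.p d₁.p d₁.fac, d.i,
    Fin.forall_fin_two.2 ⟨d.hp, d₁.hp⟩, d.hi, d₁.hi⟩

lemma exists_resolution_V [HasTerminal N] (F : V ⥤ N) {O : N} (o : O ⟶ F.obj v₀₀) :
    ∃ (G : V ⥤ N) (φ : G ⟶ F) (o' : O ⟶ G.obj v₀₀), (∀ v, W (φ.app v)) ∧ C o' ∧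
      C (G.map e₀₁) ∧ C (G.map e₁₀) := by
  let d := MorphismProperty.factorizationData C W o
  let d₀₁ := MorphismProperty.factorizationData C W (d.p ≫ F.map e₀₁)
  let d₁₀ := MorphismProperty.factorizationData C W (d.p ≫ F.map e₁₀)
  refine ⟨spanV d₁₀.i d₀₁.i, natTransV d.p d₁₀.p d₀₁.p ?_ ?_, d.i,
    forall_V d.hp d₀₁.hp d₁₀.hp, d.hi, ?_, ?_⟩
  · rw [spanV_map_e₁₀]; exact d₁₀.fac
  · rw [spanV_map_e₀₁]; exact d₀₁.fac
  · rw [spanV_map_e₀₁]; exact d₀₁.hi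
  · rw [spanV_map_e₁₀]; exact d₁₀.hi

end Factorization

variable (M : Type u) [Category.{v} M] [ModelCategory M]

/-- The cofibrations between cofibrant objects, as diagrams of shape `I`: the objects on which
`□` and the cone need not be derived. -/
def cofibrantArrows : ObjectProperty (I ⥤ M) := fun F =>
  IsCofibrant (F.obj 0) ∧ IsCofibrant (F.obj 1) ∧ Cofibration (F.map edgeI)

/-- The diagrams of shape `V` of cofibrant objects whose edge `(0, 0) ≤ (0, 1)`
is a cofibration: the objects on which the left Kan extension to `I × I` need not be derived. -/
def cofibrantSpans : ObjectProperty (V ⥤ M) := fun F =>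
  (∀ v, IsCofibrant (F.obj v)) ∧ Cofibration (F.map e₀₁)

variable [(cofibrations M).HasFunctorialFactorization (trivialFibrations M)]

-- Resolving the single diagram `(𝟭 (I ⥤ M)).flip` with values in functors `(I ⥤ M) ⥤ M`
-- resolves all diagrams in `M` functorially.
lemma nonempty_leftDeformation_cofibrantArrows :
    Nonempty (LeftDeformation (diagW M I) (cofibrantArrows M)) := by
  obtain ⟨G, φ, o, hφ, ho, hG⟩ := exists_resolution_I
    ((cofibrations M).functorCategory (I ⥤ M)) ((trivialFibrations M).functorCategory (I ⥤ M))
    (𝟭 (I ⥤ M)).flip (O := (Functor.const _).obj (⊥_ M)) { app _ := initial.to _ }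
  refine ⟨G.flip, (flipFunctor _ _ _).map φ, fun X => ?_, fun X i => (hφ i X).2⟩
  have h₀ : IsCofibrant ((G.obj 0).obj X) :=
    (isCofibrant_iff_of_isInitial (o.app X) initialIsInitial).2 ⟨ho X⟩
  have h₀₁ : Cofibration ((G.map edgeI).app X) := ⟨hG X⟩
  exact ⟨h₀, isCofibrant_of_cofibration ((G.map edgeI).app X), h₀₁⟩

lemma nonempty_leftDeformation_cofibrantSpans :
    Nonempty (LeftDeformation (diagW M V) (cofibrantSpans M)) := by
  obtain ⟨G, φ, o, hφ, ho, hG₀₁, hG₁₀⟩ := exists_resolution_V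
    ((cofibrations M).functorCategory (V ⥤ M)) ((trivialFibrations M).functorCategory (V ⥤ M))
    (𝟭 (V ⥤ M)).flip (O := (Functor.const _).obj (⊥_ M)) { app _ := initial.to _ }
  refine ⟨G.flip, (flipFunctor _ _ _).map φ, fun X => ?_, fun X i => (hφ i X).2⟩
  have h₀₀ : IsCofibrant ((G.obj v₀₀).obj X) :=
    (isCofibrant_iff_of_isInitial (o.app X) initialIsInitial).2 ⟨ho X⟩
  have h₀₁ : Cofibration ((G.map e₀₁).app X) := ⟨hG₀₁ X⟩
  have h₁₀ : Cofibration ((G.map e₁₀).app X) := ⟨hG₁₀ X⟩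
  exact ⟨forall_V h₀₀ (isCofibrant_of_cofibration ((G.map e₀₁).app X))
    (isCofibrant_of_cofibration ((G.map e₁₀).app X)), h₀₁⟩

end Resolutions

/-! ### The left Kan extension to `I × I` -/

section Corner

section Terminal

variable {C D N : Type*} [Category* C] [Category* D] [Category* N] {L : C ⥤ D} {F : C ⥤ N}
  {F' : D ⥤ N} (α : F ⟶ L ⋙ F') {T : D} (hT : IsTerminal T)

/-- The cocone over `F` with point the value at a terminal object of an extension of `F`. -/
@[simps]
def coconeAtTerminal : Cocone F where
  pt := F'.obj T
  ι :=
    { app X := α.app X ≫ F'.map (hT.from (L.obj X))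
      naturality X Y f := by
        have map_from : F'.map (hT.from (L.obj X)) =
            F'.map (L.map f) ≫ F'.map (hT.from (L.obj Y)) := by
          rw [← Functor.map_comp, IsTerminal.comp_from]
        simp [map_from] }

/-- A pointwise left Kan extension takes at a terminal object the colimit of the functor. -/
def isColimitCoconeAtTerminal
    (h : (Functor.LeftExtension.mk F' α).IsPointwiseLeftKanExtensionAt T) :
    IsColimit (coconeAtTerminal α hT) where
  desc s := h.desc (s.whisker (CostructuredArrow.proj L T))
  fac s X := h.fac (s.whisker (CostructuredArrow.proj L T)) (CostructuredArrow.mk (hT.from _))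
  uniq s m hm := h.hom_ext fun X => by
    have X_hom : X.hom = hT.from (L.obj X.left) := hT.hom_ext _ _
    rw [h.fac, Functor.LeftExtension.coconeAt_ι_app, X_hom]
    exact hm X.left

end Terminal

/-- The terminal vertex of `I × I`. -/
def isTerminalTop : IsTerminal ((1, 1) : I × I) :=
  IsTerminal.ofUniqueHom (fun p => (homOfLE (Fin.le_last p.1), homOfLE (Fin.le_last p.2)))
    fun _ _ => Subsingleton.elim _ _

lemma isPushout_of_isColimit {N : Type*} [Category* N] {F : V ⥤ N} {c : Cocone F}
    (hc : IsColimit c) :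
    IsPushout (F.map e₁₀) (F.map e₀₁) (c.ι.app v₁₀) (c.ι.app v₀₁) := by
  let cocone (s : PushoutCocone (F.map e₁₀) (F.map e₀₁)) : Cocone F :=
    { pt := s.pt
      ι := natTransV (F.map e₁₀ ≫ s.inl) s.inl s.inr (Category.comp_id _).symm
        (s.condition.symm.trans (Category.comp_id _).symm) }
  refine ⟨⟨(c.w e₁₀).trans (c.w e₀₁).symm⟩, ⟨PushoutCocone.IsColimit.mk _
    (fun s => hc.desc (cocone s)) (fun s => hc.fac (cocone s) v₁₀)
    (fun s => hc.fac (cocone s) v₀₁) fun s m hm₁₀ hm₀₁ => ?_⟩⟩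
  refine hc.uniq (cocone s) m (forall_V ?_ hm₀₁ hm₁₀)
  exact (c.w e₁₀ =≫ m).symm.trans ((Category.assoc _ _ _).trans (F.map e₁₀ ≫= hm₁₀))

variable {M : Type u} [Category.{v} M]

/-- The cocone over a diagram of shape `V` given by the vertex `(1, 1)` of its left Kan extension
to `I × I`. -/
abbrev lanCocone [HasFiniteColimits M] (F : V ⥤ M) : Cocone F :=
  coconeAtTerminal (cornerIncl.lanUnit.app F) isTerminalTop

lemma isPushout_lan [HasFiniteColimits M] (F : V ⥤ M) :
    IsPushout (F.map e₁₀) (F.map e₀₁) ((lanCocone F).ι.app v₁₀) ((lanCocone F).ι.app v₀₁) :=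
  isPushout_of_isColimit (isColimitCoconeAtTerminal _ isTerminalTop
    (cornerIncl.isPointwiseLeftKanExtensionLeftKanExtensionUnit F (1, 1)))

lemma lanUnit_naturality_app [HasFiniteColimits M] {F G : V ⥤ M} (φ : F ⟶ G) (v : V) :
    (cornerIncl.lanUnit.app F).app v ≫ (cornerIncl.lan.map φ).app v.obj =
      φ.app v ≫ (cornerIncl.lanUnit.app G).app v :=
  (NatTrans.congr_app (cornerIncl.lanUnit.naturality φ) v).symm

lemma lanCocone_naturality [HasFiniteColimits M] {F G : V ⥤ M} (φ : F ⟶ G) (v : V) :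
    (lanCocone F).ι.app v ≫ (cornerIncl.lan.map φ).app (1, 1) =
      φ.app v ≫ (lanCocone G).ι.app v := by
  have naturality := (cornerIncl.lan.map φ).naturality (isTerminalTop.from v.obj)
  exact (Category.assoc _ _ _).trans ((_ ≫= naturality).trans
    ((reassoc_of% lanUnit_naturality_app φ v) _))

lemma weakEquivalence_lan [ModelCategory M] {F G : V ⥤ M} (φ : F ⟶ G)
    (hF : cofibrantSpans M F) (hG : cofibrantSpans M G) (hφ : diagW M V φ) :
    diagW M (I × I) (cornerIncl.lan.map φ) := by
  obtain ⟨hF, _⟩ := hF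
  obtain ⟨hG, _⟩ := hG
  have hφ (v : V) : WeakEquivalence (φ.app v) := ⟨hφ v⟩
  have weq_corner (v : V) : WeakEquivalence ((cornerIncl.lan.map φ).app v.obj) :=
    weakEquivalence_of_precomp_of_fac (lanUnit_naturality_app φ v)
  have weq_top : WeakEquivalence ((cornerIncl.lan.map φ).app (1, 1)) :=
    weakEquivalence_pushoutMap (isPushout_lan F) (isPushout_lan G) (φ.naturality _)
      (φ.naturality _) (lanCocone_naturality φ v₁₀) (lanCocone_naturality φ v₀₁)
  intro p
  rw [← weakEquivalence_iff]
  by_cases hp : p = (1, 1)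
  · rwa [hp]
  · exact weq_corner ⟨p, hp⟩

end Corner

/-! ### Pushout products -/

section Tensor

lemma weakEquivalence_map_of_isCofibrant {M N : Type*} [Category* M] [ModelCategory M]
    [Category* N] [ModelCategory N] (F : M ⥤ N)
    (hF : ∀ ⦃X Y : M⦄ (f : X ⟶ Y) [Cofibration f] [WeakEquivalence f], WeakEquivalence (F.map f))
    {X Y : M} (f : X ⟶ Y) [IsCofibrant X] [IsCofibrant Y] [WeakEquivalence f] :
    WeakEquivalence (F.map f) := by
  obtain ⟨d⟩ : Nonempty (CofibrantBrownFactorization f) := inferInstance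
  have := hF d.i
  have := hF d.s
  have s_p : F.map d.s ≫ F.map d.p = 𝟙 _ := by rw [← F.map_comp, d.s_p, F.map_id]
  have : WeakEquivalence (F.map d.p) := weakEquivalence_of_precomp_of_fac s_p
  rw [← d.fac, F.map_comp]
  infer_instance

/-- The pushout-product axiom, for a tensor product that is not assumed to be symmetric or
closed. -/
class PushoutProductAxiom (M : Type*) [Category* M] [ModelCategory M] [MonoidalCategory M] :
    Prop where
  cofibration_pushoutProduct {X Y U W : M} (f : X ⟶ Y) (g : U ⟶ W) [Cofibration f]
    [Cofibration g] :
    Cofibration ((MonoidalCategory.Arrow.pushoutProduct.obj (Arrow.mk f)).obj (Arrow.mk g)).hom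
  weakEquivalence_pushoutProduct {X Y U W : M} (f : X ⟶ Y) (g : U ⟶ W) [Cofibration f]
    [Cofibration g] (h : WeakEquivalence f ∨ WeakEquivalence g) :
    WeakEquivalence
      ((MonoidalCategory.Arrow.pushoutProduct.obj (Arrow.mk f)).obj (Arrow.mk g)).hom

open PushoutProductAxiom

section Whisker

variable {M : Type*} [Category* M] [HasPushouts M] [HasInitial M] [MonoidalCategory M]
  {X Y : M} (f : X ⟶ Y) (W : M)

/-- The pushout product with `⊥_ M ⟶ W` on the right is whiskering by `W`, as soon as
the tensor product preserves initial objects in its second variable. -/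
def whiskerRightIsoPushoutProduct [∀ X : M, PreservesColimit (Functor.empty.{0} M) (tensorLeft X)] :
    Arrow.mk (f ▷ W) ≅
      (MonoidalCategory.Arrow.pushoutProduct.obj (Arrow.mk f)).obj (Arrow.mk (initial.to W)) :=
  have isInitial (X : M) : IsInitial (X ⊗ ⊥_ M) :=
    IsInitial.isInitialObj (tensorLeft X) _ initialIsInitial
  have : IsIso (f ▷ (⊥_ M)) := isIso_of_isInitial (isInitial X) (isInitial Y) _
  let inr := asIso (pushout.inr (f ▷ (⊥_ M)) (X ◁ initial.to W))
  Arrow.isoMk inr (Iso.refl _)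
    ((pushout.inr_desc _ _ _).trans (Category.comp_id _).symm)

/-- The pushout product with `⊥_ M ⟶ W` on the left is whiskering by `W`, as soon as
the tensor product preserves initial objects in its first variable. -/
def whiskerLeftIsoPushoutProduct [∀ X : M, PreservesColimit (Functor.empty.{0} M) (tensorRight X)] :
    Arrow.mk (W ◁ f) ≅
      (MonoidalCategory.Arrow.pushoutProduct.obj (Arrow.mk (initial.to W))).obj (Arrow.mk f) :=
  have isInitial (X : M) : IsInitial ((⊥_ M) ⊗ X) :=
    IsInitial.isInitialObj (tensorRight X) _ initialIsInitial
  have : IsIso ((⊥_ M) ◁ f) := isIso_of_isInitial (isInitial X) (isInitial Y) _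
  let inl := asIso (pushout.inl (initial.to W ▷ X) ((⊥_ M) ◁ f))
  Arrow.isoMk inl (Iso.refl _)
    ((pushout.inl_desc _ _ _).trans (Category.comp_id _).symm)

end Whisker

variable {M : Type*} [Category* M] [ModelCategory M] [MonoidalCategory M] [PushoutProductAxiom M]

section Left

variable [∀ X : M, PreservesColimit (Functor.empty.{0} M) (tensorLeft X)]

instance cofibration_whiskerRight {X Y : M} (f : X ⟶ Y) [Cofibration f] (W : M) [IsCofibrant W] :
    Cofibration (f ▷ W) := by
  have := cofibration_pushoutProduct f (initial.to W)
  rw [cofibration_iff] at this ⊢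
  exact (MorphismProperty.arrow_mk_iso_iff _ (whiskerRightIsoPushoutProduct f W)).2 this

lemma weakEquivalence_whiskerRight {X Y : M} (f : X ⟶ Y) [IsCofibrant X] [IsCofibrant Y]
    [WeakEquivalence f] (W : M) [IsCofibrant W] : WeakEquivalence (f ▷ W) := by
  refine weakEquivalence_map_of_isCofibrant (tensorRight W) (fun A B i _ _ => ?_) f
  have := weakEquivalence_pushoutProduct i (initial.to W) (.inl ‹_›)
  rw [weakEquivalence_iff] at this ⊢
  exact (MorphismProperty.arrow_mk_iso_iff _ (whiskerRightIsoPushoutProduct i W)).2 this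

end Left

section Right

variable [∀ X : M, PreservesColimit (Functor.empty.{0} M) (tensorRight X)]

instance cofibration_whiskerLeft {X Y : M} (f : X ⟶ Y) [Cofibration f] (W : M) [IsCofibrant W] :
    Cofibration (W ◁ f) := by
  have := cofibration_pushoutProduct (initial.to W) f
  rw [cofibration_iff] at this ⊢
  exact (MorphismProperty.arrow_mk_iso_iff _ (whiskerLeftIsoPushoutProduct f W)).2 this

lemma weakEquivalence_whiskerLeft {X Y : M} (f : X ⟶ Y) [IsCofibrant X] [IsCofibrant Y]
    [WeakEquivalence f] (W : M) [IsCofibrant W] : WeakEquivalence (W ◁ f) := by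
  refine weakEquivalence_map_of_isCofibrant (tensorLeft W) (fun A B i _ _ => ?_) f
  have := weakEquivalence_pushoutProduct (initial.to W) i (.inr ‹_›)
  rw [weakEquivalence_iff] at this ⊢
  exact (MorphismProperty.arrow_mk_iso_iff _ (whiskerLeftIsoPushoutProduct i W)).2 this

end Right

variable [∀ X : M, PreservesColimit (Functor.empty.{0} M) (tensorLeft X)]
  [∀ X : M, PreservesColimit (Functor.empty.{0} M) (tensorRight X)]

instance isCofibrant_tensor (X W : M) [IsCofibrant X] [IsCofibrant W] : IsCofibrant (X ⊗ W) :=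
  (isCofibrant_iff_of_isInitial (initial.to X ▷ W)
    (IsInitial.isInitialObj (tensorRight W) _ initialIsInitial)).2 inferInstance

lemma weakEquivalence_tensorHom {X X' Y Y' : M} (f : X ⟶ X') (g : Y ⟶ Y') [IsCofibrant X]
    [IsCofibrant X'] [IsCofibrant Y] [IsCofibrant Y'] [WeakEquivalence f] [WeakEquivalence g] :
    WeakEquivalence (f ⊗ₘ g) := by
  have := weakEquivalence_whiskerRight f Y
  have := weakEquivalence_whiskerLeft g X'
  rw [MonoidalCategory.tensorHom_def]
  infer_instance

end Tensor

section Box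

section Strict

variable {M : Type u} [Category.{v} M] [ModelCategory M] [MonoidalCategory M]
variable (F G : I ⥤ M)

/-- The first inclusion in the source of the pushout smash product. -/
def boxInl : F.obj 1 ⊗ G.obj 0 ⟶ ((box M).obj (F, G)).obj 0 :=
  pushout.inl (F.map edgeI ▷ G.obj 0) (F.obj 0 ◁ G.map edgeI)

/-- The second inclusion in the source of the pushout smash product. -/
def boxInr : F.obj 0 ⊗ G.obj 1 ⟶ ((box M).obj (F, G)).obj 0 :=
  pushout.inr (F.map edgeI ▷ G.obj 0) (F.obj 0 ◁ G.map edgeI)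

lemma isPushout_box :
    IsPushout (F.map edgeI ▷ G.obj 0) (F.obj 0 ◁ G.map edgeI) (boxInl F G) (boxInr F G) :=
  IsPushout.of_hasPushout _ _

lemma boxInl_map : boxInl F G ≫ ((box M).obj (F, G)).map edgeI = F.obj 1 ◁ G.map edgeI :=
  pushout.inl_desc _ _ _

lemma boxInr_map : boxInr F G ≫ ((box M).obj (F, G)).map edgeI = F.map edgeI ▷ G.obj 1 :=
  pushout.inr_desc _ _ _

variable {F G} {F' G' : I ⥤ M} (φ : (F, G) ⟶ (F', G'))

lemma boxInl_naturality : boxInl F G ≫ ((box M).map φ).app 0 =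
    (φ.1.app 1 ⊗ₘ φ.2.app 0) ≫ boxInl F' G' := by
  rw [MonoidalCategory.tensorHom_def, Category.assoc]
  refine ((isPushout_box F G).inl_desc_assoc (φ.1.app 1 ▷ G.obj 0 ≫ boxInl F' G)
    (φ.1.app 0 ▷ G.obj 1 ≫ boxInr F' G) ?_ _).trans ?_
  exact (Category.assoc _ _ _).trans (_ ≫= (isPushout_box F' G).inl_desc _ _ _)

lemma boxInr_naturality : boxInr F G ≫ ((box M).map φ).app 0 =
    (φ.1.app 0 ⊗ₘ φ.2.app 1) ≫ boxInr F' G' := by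
  rw [MonoidalCategory.tensorHom_def, Category.assoc]
  refine ((isPushout_box F G).inr_desc_assoc (φ.1.app 1 ▷ G.obj 0 ≫ boxInl F' G)
    (φ.1.app 0 ▷ G.obj 1 ≫ boxInr F' G) ?_ _).trans ?_
  exact (Category.assoc _ _ _).trans (_ ≫= (isPushout_box F' G).inr_desc _ _ _)

lemma box_map_app_one : ((box M).map φ).app 1 = (φ.1.app 1 ⊗ₘ φ.2.app 1) :=
  (MonoidalCategory.tensorHom_def _ _).symm

end Strict

variable {M : Type u} [Category.{v} M] [ModelCategory M] [MonoidalCategory M]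
  [∀ X : M, PreservesColimit (Functor.empty.{0} M) (tensorLeft X)]
  [∀ X : M, PreservesColimit (Functor.empty.{0} M) (tensorRight X)] [PushoutProductAxiom M]

lemma cofibrantArrows_box {F G : I ⥤ M} (hF : cofibrantArrows M F) (hG : cofibrantArrows M G) :
    cofibrantArrows M ((box M).obj (F, G)) := by
  obtain ⟨_, _, _⟩ := hF
  obtain ⟨_, _, _⟩ := hG
  refine ⟨?_, inferInstanceAs (IsCofibrant (F.obj 1 ⊗ G.obj 1)), ?_⟩
  · have := cofibration_of_isPushout (isPushout_box F G)
    exact isCofibrant_of_cofibration (boxInl F G)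
  · exact PushoutProductAxiom.cofibration_pushoutProduct (F.map edgeI) (G.map edgeI)

lemma weakEquivalence_box {F G F' G' : I ⥤ M} (φ : (F, G) ⟶ (F', G'))
    (hF : cofibrantArrows M F) (hG : cofibrantArrows M G)
    (hF' : cofibrantArrows M F') (hG' : cofibrantArrows M G')
    (h₁ : diagW M I φ.1) (h₂ : diagW M I φ.2) : diagW M I ((box M).map φ) := by
  obtain ⟨_, _, _⟩ := hF
  obtain ⟨_, _, _⟩ := hG
  obtain ⟨_, _, _⟩ := hF'
  obtain ⟨_, _, _⟩ := hG'
  have weq₁ (i : I) : WeakEquivalence (φ.1.app i) := ⟨h₁ i⟩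
  have weq₂ (i : I) : WeakEquivalence (φ.2.app i) := ⟨h₂ i⟩
  have := weakEquivalence_tensorHom (φ.1.app 0) (φ.2.app 0)
  have := weakEquivalence_tensorHom (φ.1.app 1) (φ.2.app 0)
  have := weakEquivalence_tensorHom (φ.1.app 0) (φ.2.app 1)
  have weq_one := weakEquivalence_tensorHom (φ.1.app 1) (φ.2.app 1)
  intro i
  rw [← weakEquivalence_iff]
  fin_cases i
  · refine weakEquivalence_pushoutMap (isPushout_box F G) (isPushout_box F' G')
      (α := φ.1.app 0 ⊗ₘ φ.2.app 0) ?_ ?_ (boxInl_naturality φ) (boxInr_naturality φ)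
    · rw [← tensorHom_id, ← tensorHom_id, tensorHom_comp_tensorHom, tensorHom_comp_tensorHom,
        φ.1.naturality, Category.id_comp, Category.comp_id]
    · rw [← id_tensorHom, ← id_tensorHom, tensorHom_comp_tensorHom, tensorHom_comp_tensorHom,
        φ.2.naturality, Category.id_comp, Category.comp_id]
  · exact (box_map_app_one φ).symm ▸ weq_one

end Box

/-! ### Strict cofibres -/

section Cofiber

variable {M : Type*} [Category* M] [HasZeroObject M] [HasZeroMorphisms M]

/-- The morphism `π` is the strict cofibre of `f`, that is, its cokernel, presented as the cobase
change of `f` along the morphism to the zero object. -/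
abbrev IsCofiber {X Y Z : M} (f : X ⟶ Y) (π : Y ⟶ Z) : Prop :=
  IsPushout f (0 : X ⟶ 0) π (0 : 0 ⟶ Z)

lemma IsCofiber.map {N : Type*} [Category* N] [HasZeroObject N] [HasZeroMorphisms N]
    (F : M ⥤ N) [F.PreservesZeroMorphisms] {X Y Z : M} {f : X ⟶ Y} {π : Y ⟶ Z}
    [PreservesColimit (span f (0 : X ⟶ 0)) F] (h : IsCofiber f π) :
    IsCofiber (F.map f) (F.map π) :=
  (IsPushout.map F h).of_iso (Iso.refl _) (Iso.refl _) F.mapZeroObject (Iso.refl _)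
    (by simp) (HasZeroObject.to_zero_ext _ _) (by simp)
    (F.mapZeroObject.cancel_iso_inv_left _ _ |>.1 (HasZeroObject.from_zero_ext _ _))

/-- The square with edges `p`, `π ▷ W`, `q`, `Z ◁ g`, where `q` is `π ▷ U` on `Y ⊗ U` and zero on
`X ⊗ W`, is a pushout. -/
lemma IsCofiber.tensorHom [MonoidalCategory M] [∀ X : M, PreservesFiniteColimits (tensorLeft X)]
    [∀ X : M, PreservesFiniteColimits (tensorRight X)]
    {X Y Z U W T P : M} {f : X ⟶ Y} {π : Y ⟶ Z} {g : U ⟶ W} {π' : W ⟶ T}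
    (h : IsCofiber f π) (h' : IsCofiber g π') {a : Y ⊗ U ⟶ P} {b : X ⊗ W ⟶ P}
    (sq : IsPushout (f ▷ U) (X ◁ g) a b) {p : P ⟶ Y ⊗ W} (ha : a ≫ p = Y ◁ g)
    (hb : b ≫ p = f ▷ W) : IsCofiber p (π ⊗ₘ π') := by
  have (X : M) : (tensorLeft X).PreservesZeroMorphisms :=
    Functor.preservesZeroMorphisms_of_preserves_initial_object
  have (X : M) : (tensorRight X).PreservesZeroMorphisms :=
    Functor.preservesZeroMorphisms_of_preserves_initial_object
  have cofiber_U : IsCofiber (f ▷ U) (π ▷ U) := h.map (tensorRight U)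
  have cofiber_W : IsCofiber (f ▷ W) (π ▷ W) := h.map (tensorRight W)
  have cofiber_Z : IsCofiber (Z ◁ g) (Z ◁ π') := h'.map (tensorLeft Z)
  let q : P ⟶ Z ⊗ U := sq.desc (π ▷ U) 0 (by rw [cofiber_U.w, zero_comp, comp_zero])
  have a_q : a ≫ q = π ▷ U := sq.inl_desc _ _ _
  have b_q : b ≫ q = 0 := sq.inr_desc _ _ _
  have p_q : p ≫ π ▷ W = q ≫ Z ◁ g := sq.hom_ext
    (by rw [reassoc_of% ha, reassoc_of% a_q, whisker_exchange])
    (by rw [reassoc_of% hb, reassoc_of% b_q, cofiber_W.w, zero_comp, zero_comp])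
  have cofiber_b : IsCofiber b q :=
    IsPushout.of_top (h₁₁ := f ▷ U) (v₁₁ := X ◁ g) (v₁₂ := a)
      (by simpa only [comp_zero, a_q] using cofiber_U) (by simp [b_q]) sq
  have sq_q : IsPushout p q (π ▷ W) (Z ◁ g) :=
    IsPushout.of_left (by simpa only [hb, zero_comp] using cofiber_W) p_q cofiber_b
  simpa only [IsCofiber, MonoidalCategory.tensorHom_def, comp_zero] using sq_q.paste_vert cofiber_Z

lemma nonempty_iso_of_isCofiber {K : Type*} [Category* K] (T E E' : K ⥤ I ⥤ M)
    (a : T ⋙ (evaluation I M).obj 1 ≅ E ⋙ (evaluation I M).obj 0)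
    (a' : T ⋙ (evaluation I M).obj 1 ≅ E' ⋙ (evaluation I M).obj 0)
    (h : ∀ k, IsCofiber ((T.obj k).map edgeI) (a.hom.app k ≫ (E.obj k).map edgeI))
    (h' : ∀ k, IsCofiber ((T.obj k).map edgeI) (a'.hom.app k ≫ (E'.obj k).map edgeI)) :
    Nonempty (E ≅ E') := by
  let source : E ⋙ (evaluation I M).obj 0 ≅ E' ⋙ (evaluation I M).obj 0 := a.symm ≪≫ a'
  let target (k : K) : (E.obj k).obj 1 ≅ (E'.obj k).obj 1 :=
    IsPushout.isoIsPushout _ _ (h k) (h' k)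
  have source_target (k : K) :
      (E.obj k).map edgeI ≫ (target k).hom = source.hom.app k ≫ (E'.obj k).map edgeI := by
    rw [← cancel_epi (a.hom.app k), ← Category.assoc]
    exact (IsPushout.inl_isoIsPushout_hom _ _ (h k) (h' k)).trans (by simp [source])
  have target_naturality {k k' : K} (f : k ⟶ k') :
      (E.map f).app 1 ≫ (target k').hom = (target k).hom ≫ (E'.map f).app 1 := by
    have source_naturality : (E.map f).app 0 ≫ source.hom.app k' =
      source.hom.app k ≫ (E'.map f).app 0 := source.hom.naturality f
    refine (h k).hom_ext ?_ (HasZeroObject.from_zero_ext _ _)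
    rw [Category.assoc, Category.assoc, NatTrans.naturality_assoc, source_target,
      reassoc_of% source_naturality, reassoc_of% source_target, NatTrans.naturality]
  exact ⟨NatIso.ofComponents
    (fun k => ComposableArrows.isoMk₁ (source.app k) (target k) (source_target k))
    fun f => ComposableArrows.hom_ext₁ (source.hom.naturality f) (target_naturality f)⟩

end Cofiber

section StrictCone

section StarDiagram

variable {M : Type u} [Category.{v} M] [HasZeroObject M] [HasZeroMorphisms M]

lemma starDiagram_map_e₀₁ (F : I ⥤ M) : ((starDiagram M).obj F).map e₀₁ = F.map edgeI :=
  Category.id_comp (F.map edgeI)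

lemma starDiagram_map_e₁₀ (F : I ⥤ M) :
    ((starDiagram M).obj F).map e₁₀ = (0 : F.obj 0 ⟶ (0 : M)) :=
  Category.comp_id (0 : F.obj 0 ⟶ (0 : M))

end StarDiagram

variable (M : Type u) [Category.{v} M] [ModelCategory M] [HasZeroObject M] [HasZeroMorphisms M]

/-- The strict cone inclusion functor, whose left derived functor is the cone inclusion functor:
it sends `f : X ⟶ Y` to the strict cofibre `Y ⟶ Y / X`. -/
def strictCone : (I ⥤ M) ⥤ (I ⥤ M) :=
  starDiagram M ⋙ cornerIncl.lan ⋙ (edgeLocalizerMorphism M).functor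

/-- The source of the strict cone inclusion of `f : X ⟶ Y` is `Y`. -/
def strictConeSource :
    (evaluation I M).obj 1 ≅ strictCone M ⋙ (evaluation I M).obj 0 :=
  Functor.isoWhiskerLeft (starDiagram M) (Functor.isoWhiskerRight
    (asIso (cornerIncl.lanUnit (H := M))) ((evaluation V M).obj v₀₁))

variable {M}

lemma isCofiber_strictCone (F : I ⥤ M) : IsCofiber (F.map edgeI)
    ((strictConeSource M).hom.app F ≫ ((strictCone M).obj F).map edgeI) := by
  have sq := (isPushout_lan ((starDiagram M).obj F)).flip
  have ι_v₁₀ : (lanCocone ((starDiagram M).obj F)).ι.app v₁₀ = (0 : (0 : M) ⟶ _) :=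
    HasZeroObject.from_zero_ext _ _
  rw [starDiagram_map_e₀₁, starDiagram_map_e₁₀, ι_v₁₀] at sq
  exact sq

variable [MonoidalCategory M]

variable (M) in
lemma nonempty_box_strictCone_iso [∀ X : M, PreservesFiniteColimits (tensorLeft X)]
    [∀ X : M, PreservesFiniteColimits (tensorRight X)] :
    Nonempty (box M ⋙ strictCone M ≅ (strictCone M).prod (strictCone M) ⋙ smash M) := by
  let e := strictConeSource M
  let boxSource : box M ⋙ (evaluation I M).obj 1 ≅
      ((strictCone M).prod (strictCone M) ⋙ smash M) ⋙ (evaluation I M).obj 0 :=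
    NatIso.ofComponents (fun X => MonoidalCategory.tensorIso (e.app X.1) (e.app X.2))
      (fun {X Y} φ => (box_map_app_one φ =≫ _).trans <|
        (MonoidalCategory.tensorHom_comp_tensorHom _ _ _ _).trans <|
        (congrArg₂ (fun a b => a ⊗ₘ b) (e.hom.naturality φ.1) (e.hom.naturality φ.2)).trans
        (MonoidalCategory.tensorHom_comp_tensorHom _ _ _ _).symm)
  refine nonempty_iso_of_isCofiber (box M) _ _ (Functor.isoWhiskerLeft (box M) e) boxSource
    (fun X => isCofiber_strictCone _) (fun X => ?_)
  have cofiber := (isCofiber_strictCone X.1).tensorHom (isCofiber_strictCone X.2)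
    (isPushout_box X.1 X.2) (boxInl_map X.1 X.2) (boxInr_map X.1 X.2)
  rw [← MonoidalCategory.tensorHom_comp_tensorHom] at cofiber
  exact cofiber

end StrictCone

/-! ### Derived cones and products -/

section TwoOutOfThree

variable {C D : Type*} [Category* C] [Category* D] (W : MorphismProperty C)
  (W' : MorphismProperty D) [W.HasTwoOutOfThreeProperty]

instance functorCategory_hasTwoOutOfThreeProperty (J : Type*) [Category* J] :
    (W.functorCategory J).HasTwoOutOfThreeProperty where
  comp_mem _ _ hf hg j := W.comp_mem _ _ (hf j) (hg j)
  of_postcomp _ _ hg hfg j := W.of_postcomp _ _ (hg j) (hfg j)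
  of_precomp _ _ hf hfg j := W.of_precomp _ _ (hf j) (hfg j)

instance prod_hasTwoOutOfThreeProperty [W'.HasTwoOutOfThreeProperty] :
    (W.prod W').HasTwoOutOfThreeProperty where
  comp_mem _ _ hf hg := ⟨W.comp_mem _ _ hf.1 hg.1, W'.comp_mem _ _ hf.2 hg.2⟩
  of_postcomp _ _ hg hfg := ⟨W.of_postcomp _ _ hg.1 hfg.1, W'.of_postcomp _ _ hg.2 hfg.2⟩
  of_precomp _ _ hf hfg := ⟨W.of_precomp _ _ hf.1 hfg.1, W'.of_precomp _ _ hf.2 hfg.2⟩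

end TwoOutOfThree

open scoped TwoSquare

section TwoSquares

lemma isIso_vComp_app {C₁ C₂ C₃ C₄ C₅ C₆ : Type*} [Category* C₁] [Category* C₂] [Category* C₃]
    [Category* C₄] [Category* C₅] [Category* C₆] {T : C₁ ⥤ C₂} {L : C₁ ⥤ C₃} {R : C₂ ⥤ C₄}
    {B : C₃ ⥤ C₄} {L' : C₃ ⥤ C₅} {R' : C₄ ⥤ C₆} {B' : C₅ ⥤ C₆} (w : TwoSquare T L R B)
    (w' : TwoSquare B L' R' B') {X : C₁} (hw : IsIso (w.natTrans.app X))
    (hw' : IsIso (w'.natTrans.app (L.obj X))) : IsIso ((w ≫ᵥ w').natTrans.app X) := by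
  rw [TwoSquare.vComp_app]
  infer_instance

/-- The product of two squares of functors. -/
def prodSquare {C₁ C₂ C₃ C₄ D₁ D₂ D₃ D₄ : Type*} [Category* C₁] [Category* C₂] [Category* C₃]
    [Category* C₄] [Category* D₁] [Category* D₂] [Category* D₃] [Category* D₄] {T : C₁ ⥤ C₂}
    {L : C₁ ⥤ C₃} {R : C₂ ⥤ C₄} {B : C₃ ⥤ C₄} {T' : D₁ ⥤ D₂} {L' : D₁ ⥤ D₃} {R' : D₂ ⥤ D₄}
    {B' : D₃ ⥤ D₄} (w : TwoSquare T L R B) (w' : TwoSquare T' L' R' B') :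
    TwoSquare (T.prod T') (L.prod L') (R.prod R') (B.prod B') :=
  NatTrans.prod w.natTrans w'.natTrans

/-- The square relating a functor that preserves weak equivalences to the induced functor
between localizations. -/
def localizedSquare {C D : Type*} [Category* C] [Category* D] {W : MorphismProperty C}
    {W' : MorphismProperty D} (Φ : LocalizerMorphism W W') :
    TwoSquare W.Q Φ.functor (Φ.localizedFunctor W.Q W'.Q) W'.Q :=
  (CatCommSq.iso Φ.functor W.Q W'.Q (Φ.localizedFunctor W.Q W'.Q)).inv

lemma isIso_localizedSquare_app {C D : Type*} [Category* C] [Category* D]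
    {W : MorphismProperty C} {W' : MorphismProperty D} (Φ : LocalizerMorphism W W') (X : C) :
    IsIso ((localizedSquare Φ).natTrans.app X) :=
  inferInstanceAs (IsIso ((CatCommSq.iso _ _ _ _).inv.app X))

end TwoSquares

variable (M : Type u) [Category.{v} M] [ModelCategory M]

variable {M} in
lemma isIso_toHo_map {J : Type} [Category.{0} J] {X Y : J ⥤ M} (f : X ⟶ Y) (hf : diagW M J f) :
    IsIso ((toHo M J).map f) :=
  Localization.inverts (toHo M J) (diagW M J) f hf

section DerivedCone

variable {M} in
lemma isIso_cornerLan_map ⦃F G : V ⥤ M⦄ (φ : F ⟶ G) (hF : cofibrantSpans M F)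
    (hG : cofibrantSpans M G) (hφ : diagW M V φ) : IsIso ((cornerLan M).map φ) :=
  isIso_toHo_map _ (weakEquivalence_lan φ hF hG hφ)

instance hasLeftDerivedFunctor_cornerLan
    [(cofibrations M).HasFunctorialFactorization (trivialFibrations M)] :
    (cornerLan M).HasLeftDerivedFunctor (diagW M V) := by
  obtain ⟨d⟩ := nonempty_leftDeformation_cofibrantSpans M
  exact d.hasLeftDerivedFunctor isIso_cornerLan_map

/-- The counit of the left homotopy Kan extension. -/
def cornerHoLanCounit [(cornerLan M).HasLeftDerivedFunctor (diagW M V)] :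
    TwoSquare (toHo M V) cornerIncl.lan (cornerHoLan M) (toHo M (I × I)) :=
  (cornerLan M).totalLeftDerivedCounit (toHo M V) (diagW M V)

variable [HasZeroObject M] [HasZeroMorphisms M]

/-- The comparison from the cone inclusion functor to the strict cone inclusion functor. -/
def coneCounit [(cornerLan M).HasLeftDerivedFunctor (diagW M V)] :
    TwoSquare (toHo M I) (strictCone M) (coneInclusion M) (toHo M I) :=
  localizedSquare (starLocalizerMorphism M) ≫ᵥ cornerHoLanCounit M ≫ᵥ
    localizedSquare (edgeLocalizerMorphism M)

variable {M}

instance isCofibrant_zero : IsCofibrant (0 : M) :=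
  (isCofibrant_iff_of_isInitial (𝟙 (0 : M)) (isZero_zero M).isInitial).2 inferInstance

lemma cofibrantSpans_starDiagram {F : I ⥤ M} (hF : cofibrantArrows M F) :
    cofibrantSpans M ((starDiagram M).obj F) :=
  ⟨forall_V hF.1 hF.2.1 isCofibrant_zero, (starDiagram_map_e₀₁ F).symm ▸ hF.2.2⟩

lemma isIso_coneCounit_app [(cofibrations M).HasFunctorialFactorization (trivialFibrations M)]
    {F : I ⥤ M} (hF : cofibrantArrows M F) : IsIso ((coneCounit M).natTrans.app F) := by
  obtain ⟨d⟩ := nonempty_leftDeformation_cofibrantSpans M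
  have isIso_cornerHoLanCounit : IsIso ((cornerHoLanCounit M).natTrans.app _) :=
    d.isIso_app_of_isLeftDerivedFunctor isIso_cornerLan_map
      ((cornerLan M).totalLeftDerivedCounit (toHo M V) (diagW M V)) (cofibrantSpans_starDiagram hF)
  exact isIso_vComp_app _ _ (isIso_localizedSquare_app _ _)
    (isIso_vComp_app _ _ isIso_cornerHoLanCounit (isIso_localizedSquare_app _ _))

end DerivedCone

section DerivedProducts

/-- The diagrams of shape `I` of cofibrant objects: the objects on which `∧_I` need not be
derived. -/
def vertexwiseCofibrant : ObjectProperty (I ⥤ M) := fun F => ∀ i, IsCofibrant (F.obj i)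

lemma cofibrantArrows_le_vertexwiseCofibrant : cofibrantArrows M ≤ vertexwiseCofibrant M :=
  fun _ hF => Fin.forall_fin_two.2 ⟨hF.1, hF.2.1⟩

variable {M} in
lemma vertexwiseCofibrant_strictCone [HasZeroObject M] [HasZeroMorphisms M] {F : I ⥤ M}
    (hF : cofibrantArrows M F) : vertexwiseCofibrant M ((strictCone M).obj F) := by
  obtain ⟨_, cofibrant_target, _⟩ := hF
  have : IsCofibrant (((evaluation I M).obj 1).obj F) := cofibrant_target
  have cofibration_zero := cofibration_of_isPushout (isCofiber_strictCone F).flip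
  exact Fin.forall_fin_two.2 ⟨isCofibrant_of_cofibration ((strictConeSource M).hom.app F),
    (isCofibrant_iff_of_isInitial _ (isZero_zero M).isInitial).2 cofibration_zero⟩

section Resolutions

variable [(cofibrations M).HasFunctorialFactorization (trivialFibrations M)]

lemma nonempty_leftDeformation_cofibrantArrows₂ :
    Nonempty (LeftDeformation ((diagW M I).prod (diagW M I))
      fun X => cofibrantArrows M X.1 ∧ cofibrantArrows M X.2) :=
  (nonempty_leftDeformation_cofibrantArrows M).map fun d => d.prod d

lemma nonempty_leftDeformation_vertexwiseCofibrant₂ :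
    Nonempty (LeftDeformation ((diagW M I).prod (diagW M I))
      fun X => vertexwiseCofibrant M X.1 ∧ vertexwiseCofibrant M X.2) :=
  (nonempty_leftDeformation_cofibrantArrows₂ M).map fun d => d.ofLE fun _ hX =>
    hX.imp (cofibrantArrows_le_vertexwiseCofibrant M _)
      (cofibrantArrows_le_vertexwiseCofibrant M _)

end Resolutions

variable [MonoidalCategory M]

/-- The counit of the total left derived functor of a functor of two variables. -/
def derived₂Counit (F : (I ⥤ M) × (I ⥤ M) ⥤ (I ⥤ M)) [HasDerived₂ M F] :
    TwoSquare ((toHo M I).prod (toHo M I)) F (derived₂ M F) (toHo M I) :=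
  (F ⋙ toHo M I).totalLeftDerivedCounit ((toHo M I).prod (toHo M I))
    ((diagW M I).prod (diagW M I))

instance isLeftDerivedFunctor_derived₂ (F : (I ⥤ M) × (I ⥤ M) ⥤ (I ⥤ M)) [HasDerived₂ M F] :
    (derived₂ M F).IsLeftDerivedFunctor (derived₂Counit M F).natTrans
      ((diagW M I).prod (diagW M I)) :=
  inferInstanceAs (((F ⋙ toHo M I).totalLeftDerived _ _).IsLeftDerivedFunctor
    ((F ⋙ toHo M I).totalLeftDerivedCounit _ _) _)

variable [∀ X : M, PreservesColimit (Functor.empty.{0} M) (tensorLeft X)]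
  [∀ X : M, PreservesColimit (Functor.empty.{0} M) (tensorRight X)] [PushoutProductAxiom M]

variable {M} in
lemma isIso_box_map ⦃X Y : (I ⥤ M) × (I ⥤ M)⦄ (φ : X ⟶ Y)
    (hX : cofibrantArrows M X.1 ∧ cofibrantArrows M X.2)
    (hY : cofibrantArrows M Y.1 ∧ cofibrantArrows M Y.2)
    (hφ : ((diagW M I).prod (diagW M I)) φ) : IsIso ((box M ⋙ toHo M I).map φ) :=
  isIso_toHo_map _ (weakEquivalence_box φ hX.1 hX.2 hY.1 hY.2 hφ.1 hφ.2)

variable {M} in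
lemma isIso_smash_map ⦃X Y : (I ⥤ M) × (I ⥤ M)⦄ (φ : X ⟶ Y)
    (hX : vertexwiseCofibrant M X.1 ∧ vertexwiseCofibrant M X.2)
    (hY : vertexwiseCofibrant M Y.1 ∧ vertexwiseCofibrant M Y.2)
    (hφ : ((diagW M I).prod (diagW M I)) φ) : IsIso ((smash M ⋙ toHo M I).map φ) := by
  refine isIso_toHo_map _ fun i => ?_
  obtain ⟨_, _⟩ := And.intro (hX.1 i) (hX.2 i)
  obtain ⟨_, _⟩ := And.intro (hY.1 i) (hY.2 i)
  have : WeakEquivalence (φ.1.app i) := ⟨hφ.1 i⟩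
  have : WeakEquivalence (φ.2.app i) := ⟨hφ.2 i⟩
  exact (weakEquivalence_tensorHom (φ.1.app i) (φ.2.app i)).mem

variable [(cofibrations M).HasFunctorialFactorization (trivialFibrations M)]

instance hasDerived₂_box : HasDerived₂ M (box M) := by
  obtain ⟨d⟩ := nonempty_leftDeformation_cofibrantArrows₂ M
  exact d.hasLeftDerivedFunctor isIso_box_map

instance hasDerived₂_smash : HasDerived₂ M (smash M) := by
  obtain ⟨d⟩ := nonempty_leftDeformation_vertexwiseCofibrant₂ M
  exact d.hasLeftDerivedFunctor isIso_smash_map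

variable [HasZeroObject M] [HasZeroMorphisms M]

/-- The comparison from the cone of the derived pushout smash product to the strict version. -/
def boxConeCounit : TwoSquare ((toHo M I).prod (toHo M I)) (box M ⋙ strictCone M)
    (derived₂ M (box M) ⋙ coneInclusion M) (toHo M I) :=
  derived₂Counit M (box M) ≫ᵥ coneCounit M

/-- The comparison from the derived internal smash product of cones to the strict version. -/
def smashConeCounit : TwoSquare ((toHo M I).prod (toHo M I))
    ((strictCone M).prod (strictCone M) ⋙ smash M)
    ((coneInclusion M).prod (coneInclusion M) ⋙ derived₂ M (smash M)) (toHo M I) :=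
  prodSquare (coneCounit M) (coneCounit M) ≫ᵥ derived₂Counit M (smash M)

variable {M} {X : (I ⥤ M) × (I ⥤ M)}

lemma isIso_boxConeCounit_app (hX : cofibrantArrows M X.1 ∧ cofibrantArrows M X.2) :
    IsIso ((boxConeCounit M).natTrans.app X) := by
  obtain ⟨d⟩ := nonempty_leftDeformation_cofibrantArrows₂ M
  exact isIso_vComp_app _ _ (d.isIso_app_of_isLeftDerivedFunctor isIso_box_map _ hX)
    (isIso_coneCounit_app (cofibrantArrows_box hX.1 hX.2))

lemma isIso_smashConeCounit_app (hX : cofibrantArrows M X.1 ∧ cofibrantArrows M X.2) :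
    IsIso ((smashConeCounit M).natTrans.app X) := by
  obtain ⟨d⟩ := nonempty_leftDeformation_vertexwiseCofibrant₂ M
  have isIso_prodSquare : IsIso ((prodSquare (coneCounit M) (coneCounit M)).natTrans.app X) :=
    (isIso_prod_iff _ _).2 ⟨isIso_coneCounit_app hX.1, isIso_coneCounit_app hX.2⟩
  exact isIso_vComp_app _ _ isIso_prodSquare
    (d.isIso_app_of_isLeftDerivedFunctor isIso_smash_map _
      ⟨vertexwiseCofibrant_strictCone hX.1, vertexwiseCofibrant_strictCone hX.2⟩)

end DerivedProducts

instance pushoutProductAxiom_of_monoidalModelCategory (M : Type u) [Category.{v} M]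
    [ModelCategory M] [MonoidalCategory M] [MonoidalModelCategory M] : PushoutProductAxiom M where
  cofibration_pushoutProduct _ _ _ _ :=
    MonoidalModelCategory.cofibration_pushoutProduct _ _ ‹_› ‹_›
  weakEquivalence_pushoutProduct _ _ _ _ h :=
    MonoidalModelCategory.weakEquivalence_pushoutProduct _ _ ‹_› ‹_› h

end DiagramCone

open DiagramCone in
theorem mainTheorem5_general (M : Type u) [Category.{v} M] [ModelCategory M]
    [(cofibrations M).HasFunctorialFactorization (trivialFibrations M)] [HasZeroObject M]
    [HasZeroMorphisms M] [MonoidalCategory M] [∀ X : M, PreservesFiniteColimits (tensorLeft X)]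
    [∀ X : M, PreservesFiniteColimits (tensorRight X)] [PushoutProductAxiom M] :
    ∃ (_ : (cornerLan M).HasLeftDerivedFunctor (diagW M V)) (_ : HasDerived₂ M (box M))
      (_ : HasDerived₂ M (smash M)),
      Nonempty (derived₂ M (box M) ⋙ coneInclusion M ≅
        (coneInclusion M).prod (coneInclusion M) ⋙ derived₂ M (smash M)) := by
  obtain ⟨d⟩ := nonempty_leftDeformation_cofibrantArrows₂ M
  obtain ⟨strictIso⟩ := nonempty_box_strictCone_iso M
  have boxCone_isLeftDerivedFunctor :=
    d.isLeftDerivedFunctor_of_isIso_app (boxConeCounit M).natTrans fun _ => isIso_boxConeCounit_app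
  have smashCone_isLeftDerivedFunctor :=
    d.isLeftDerivedFunctor_of_isIso_app (smashConeCounit M).natTrans
      fun _ => isIso_smashConeCounit_app
  exact ⟨inferInstance, inferInstance, inferInstance,
    ⟨Functor.leftDerivedNatIso _ _ (boxConeCounit M).natTrans (smashConeCounit M).natTrans
      ((diagW M I).prod (diagW M I)) (Functor.isoWhiskerRight strictIso (toHo M I))⟩⟩

end

theorem mainTheorem5 (M : Type u) [Category.{v} M] [ModelCategory M] [HasZeroObject M]
    [HasZeroMorphisms M] [MonoidalCategory M] [DiagramCone.MonoidalModelCategory M] :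
    ∃ (_ : (DiagramCone.cornerLan M).HasLeftDerivedFunctor
          (DiagramCone.diagW M DiagramCone.V))
      (_ : DiagramCone.HasDerived₂ M (DiagramCone.box M))
      (_ : DiagramCone.HasDerived₂ M (DiagramCone.smash M)),
      Nonempty
        (DiagramCone.derived₂ M (DiagramCone.box M) ⋙ DiagramCone.coneInclusion M ≅
          (DiagramCone.coneInclusion M).prod (DiagramCone.coneInclusion M) ⋙
            DiagramCone.derived₂ M (DiagramCone.smash M)) := by
  have (X : M) := DiagramCone.MonoidalModelCategory.tensorLeft_isLeftAdjoint X
  have (X : M) := DiagramCone.MonoidalModelCategory.tensorRight_isLeftAdjoint X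
  have := DiagramCone.MonoidalModelCategory.functorialFactorization_trivialFibration (M := M)
  exact mainTheorem5_general M
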